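/- A two-qubit state is a positive semidefinite $4\times4$ complex matrix $\rho$ of trace one, acting on $\mathbb C^2\otimes\mathbb C^2$. It is separable if it is a finite convex combination of product states $\rho_A\otimes\rho_B$, with $\rho_A,\rho_B$ states on $\mathbb C^2$, and absolutely separable if $U\rho U^\dagger$ is separable for every unitary $U$ on $\mathbb C^2\otimes\mathbb C^2$. Let $\mathbf{AS}$ be the set of absolutely separable two-qubit states, and let the maximal ball be the set of two-qubit states with $\operatorname{Tr}(\rho^2)\le\frac13$. There exist absolutely separable two-qubit states $\rho$ of rank $4$ that lie outside the maximal ball, i.e. $\operatorname{Tr}(\rho^2)>\frac13$, and that are extreme points of $\mathbf{AS}$. -/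

import Mathlib

open scoped ComplexOrder Kronecker Matrix

namespace QState

/-- The density matrices (quantum states) on the Hilbert space `ℂ^ι`: positive semidefinite
complex matrices of trace one. -/
def states (ι : Type*) [Fintype ι] : Set (Matrix ι ι ℂ) :=
  {ρ | ρ.PosSemidef ∧ ρ.trace = 1}

/-- The product states `ρ ⊗ σ` on `ℂ^m ⊗ ℂ^n = ℂ^(m × n)`. -/
def productStates (m n : Type*) [Fintype m] [Fintype n] : Set (Matrix (m × n) (m × n) ℂ) :=
  {τ | ∃ ρ ∈ states m, ∃ σ ∈ states n, τ = ρ ⊗ₖ σ}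

/-- The separable states: the (finite) convex combinations of product states. A bipartite state is
entangled if it is not separable. -/
def separableStates (m n : Type*) [Fintype m] [Fintype n] : Set (Matrix (m × n) (m × n) ℂ) :=
  convexHull ℝ (productStates m n)

/-- The set **AS** of absolutely separable states: the states `ρ` such that `U ρ U†` is separable
for every global unitary `U`. -/
def absolutelySeparable (m n : Type*) [Fintype m] [Fintype n] [DecidableEq m] [DecidableEq n] :
    Set (Matrix (m × n) (m × n) ℂ) :=
  {ρ | ρ ∈ states (m × n) ∧
    ∀ U ∈ Matrix.unitaryGroup (m × n) ℂ, U * ρ * Uᴴ ∈ separableStates m n}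

/-- The purity `Tr ρ²`, a real number when `ρ` is Hermitian. -/
noncomputable def purity {ι : Type*} [Fintype ι] (ρ : Matrix ι ι ℂ) : ℝ :=
  (ρ * ρ).trace.re

/-- The maximal ball of two-qubit states around the maximally mixed state: `Tr ρ² ≤ 1/3`. -/
def maximalBall : Set (Matrix (Fin 2 × Fin 2) (Fin 2 × Fin 2) ℂ) :=
  {ρ | ρ ∈ states (Fin 2 × Fin 2) ∧ purity ρ ≤ 1 / 3}

end QState

/-! The example is diagonal with spectrum proportional to `(r², r², 1, 1)`, where `r = 1 + √2`, so
that `r² = 2r + 1`; its purity is `3/8`.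

Absolute separability. Up to scale, every unitary conjugate is `1 + 2r P` with `P` a projection of
rank two. In the magic basis, product vectors are the isotropic vectors `z ⬝ᵥ z = 0`, so it suffices
to write `1 + 2r P` as a sum of four terms `z z†` with `z` isotropic
(`exists_isotropic_decomposition`). Takagi diagonalization of the bilinear form on the range of `P`
yields a real orthonormal frame that splits the problem into two real planes. In each plane the
matrix is a sum of two rank one terms on which the form takes the same value `r`; a vector from one
plane plus `±i` times a vector from the other is then isotropic.

Extremality. A partially transposed projection is an entanglement witness with eigenvalues `r², 1,
r, -r`, so each orthonormal frame gives a linear inequality on absolutely separable states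
(`diag_inequality`). The example saturates it for every rotation inside either eigenspace. Hence so
do both members of any convex decomposition, and saturation forces their diagonal blocks to be
scalar and their off-diagonal blocks to vanish; the trace does the rest (`eq_twoLevelState`). -/

namespace QState

/-! ### An entanglement witness. -/

section Witness

/-- Positivity on product states of the partial transpose of the projection onto
`r |00⟩ + |11⟩`. -/
theorem witness_nonneg_of_mem_separableStates (r : ℝ)
    {τ : Matrix (Fin 2 × Fin 2) (Fin 2 × Fin 2) ℂ}
    (hτ : τ ∈ separableStates (Fin 2) (Fin 2)) :
    0 ≤ r ^ 2 * (τ (0, 0) (0, 0)).re + (τ (1, 1) (1, 1)).re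
      + r * ((τ (0, 1) (1, 0)).re + (τ (1, 0) (0, 1)).re) := by
  have key : separableStates (Fin 2) (Fin 2) ⊆ {τ | 0 ≤ r ^ 2 * (τ (0, 0) (0, 0)).re
      + (τ (1, 1) (1, 1)).re + r * ((τ (0, 1) (1, 0)).re + (τ (1, 0) (0, 1)).re)} := by
    refine convexHull_min ?_ ?_
    · rintro _ ⟨A, ⟨hA, -⟩, B, ⟨hB, -⟩, rfl⟩
      -- The partial transpose of a product state is `A ⊗ Bᵀ`, still positive semidefinite; it is
      -- tested on `r |00⟩ + |11⟩`.
      have h := (hA.kronecker hB.transpose).dotProduct_mulVec_nonneg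
        (fun i => if i = (0, 0) then (r : ℂ) else if i = (1, 1) then 1 else 0)
      have h' := (Complex.le_def.1 h).1
      simp [dotProduct, Matrix.mulVec, Fintype.sum_prod_type, Fin.sum_univ_two] at h'
      simp only [Set.mem_ofPred_eq, Matrix.kroneckerMap_apply, Complex.mul_re]
      linarith
    · intro x hx y hy s t hs ht _
      simp only [Set.mem_ofPred_eq, Matrix.add_apply, Matrix.smul_apply, Complex.add_re,
        Complex.real_smul, Complex.re_ofReal_mul] at hx hy ⊢
      have h1 := mul_nonneg hs hx
      have h2 := mul_nonneg ht hy
      linarith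
  exact key hτ

end Witness

/-! ### Invariance of absolute separability under unitaries and permutations of the basis. -/

section UnitaryInvariance

variable {m n : Type*} [Fintype m] [Fintype n] [DecidableEq m] [DecidableEq n]

theorem conj_mem_states {ι : Type*} [Fintype ι] [DecidableEq ι] {ρ : Matrix ι ι ℂ}
    (hρ : ρ ∈ states ι) {U : Matrix ι ι ℂ} (hU : U ∈ Matrix.unitaryGroup ι ℂ) :
    U * ρ * Uᴴ ∈ states ι := by
  refine ⟨hρ.1.mul_mul_conjTranspose_same U, ?_⟩
  rw [Matrix.trace_mul_cycle, ← Matrix.star_eq_conjTranspose, Matrix.mem_unitaryGroup_iff'.1 hU,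
    one_mul, hρ.2]

theorem conj_mem_absolutelySeparable {ρ : Matrix (m × n) (m × n) ℂ}
    (hρ : ρ ∈ absolutelySeparable m n) {U : Matrix (m × n) (m × n) ℂ}
    (hU : U ∈ Matrix.unitaryGroup (m × n) ℂ) : U * ρ * Uᴴ ∈ absolutelySeparable m n := by
  refine ⟨conj_mem_states hρ.1 hU, fun V hV => ?_⟩
  have := hρ.2 (V * U) (mul_mem hV hU)
  simpa [Matrix.conjTranspose_mul, Matrix.mul_assoc] using this

theorem submatrix_mem_absolutelySeparable {ρ : Matrix (m × n) (m × n) ℂ}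
    (hρ : ρ ∈ absolutelySeparable m n) (e : Equiv.Perm (m × n)) :
    ρ.submatrix e e ∈ absolutelySeparable m n := by
  have h1 : ((1 : Matrix (m × n) (m × n) ℂ).submatrix e id) ∈ Matrix.unitaryGroup (m × n) ℂ := by
    rw [Matrix.mem_unitaryGroup_iff]
    ext i j
    simp [Matrix.mul_apply, Matrix.one_apply, Matrix.star_apply, eq_comm]
  have h2 := conj_mem_absolutelySeparable hρ h1
  have h3 : ((1 : Matrix (m × n) (m × n) ℂ).submatrix e id) * ρ *
      ((1 : Matrix (m × n) (m × n) ℂ).submatrix e id)ᴴ = ρ.submatrix e e := by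
    ext i j
    simp [Matrix.mul_apply, Matrix.one_apply]
  rwa [h3] at h2

end UnitaryInvariance

/-! ### Linear inequalities on absolutely separable states, one for each orthonormal frame. -/

section FrameInequalities

/-- The unitary with rows `e₁₁`, `(e₁₀ + e₀₀)/√2`, `(e₁₀ - e₀₀)/√2`, `e₀₁`, sending the standard
basis to an eigenbasis of the two-qubit witness. -/
noncomputable def bellRotation : Matrix (Fin 2 × Fin 2) (Fin 2 × Fin 2) ℂ :=
  Matrix.of fun a b =>
    if a = (0, 0) then (if b = (1, 1) then 1 else 0)
    else if a = (1, 1) then (if b = (0, 1) then 1 else 0)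
    else if a = (0, 1) then
      (if b = (1, 0) then ((√2)⁻¹ : ℝ) else if b = (0, 0) then ((√2)⁻¹ : ℝ) else 0)
    else (if b = (1, 0) then ((√2)⁻¹ : ℝ) else if b = (0, 0) then (-(√2)⁻¹ : ℝ) else 0)

theorem bellRotation_mem : bellRotation ∈ Matrix.unitaryGroup (Fin 2 × Fin 2) ℂ := by
  have h : (((√2)⁻¹ : ℝ) : ℂ) * (((√2)⁻¹ : ℝ) : ℂ) = 1 / 2 := by
    rw [← Complex.ofReal_mul, ← mul_inv, Real.mul_self_sqrt (by norm_num)]; norm_num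
  push_cast at h
  rw [Matrix.mem_unitaryGroup_iff]
  ext ⟨a, b⟩ ⟨c, d⟩
  fin_cases a <;> fin_cases b <;> fin_cases c <;> fin_cases d <;>
    simp [bellRotation, Matrix.mul_apply, Fintype.sum_prod_type, Fin.sum_univ_two,
      Matrix.star_apply, h] <;> norm_num

/-- The coefficients are the eigenvalues `-r, 1, r, r²` of the witness. Unitary invariance allows
its eigenvectors to be matched with the basis vectors in any order. -/
theorem diag_inequality {r : ℝ} {σ : Matrix (Fin 2 × Fin 2) (Fin 2 × Fin 2) ℂ}
    (hσ : σ ∈ absolutelySeparable (Fin 2) (Fin 2)) (e : Equiv.Perm (Fin 2 × Fin 2)) :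
    0 ≤ -r * (σ (e (0, 0)) (e (0, 0))).re + (σ (e (0, 1)) (e (0, 1))).re
      + r * (σ (e (1, 0)) (e (1, 0))).re + r ^ 2 * (σ (e (1, 1)) (e (1, 1))).re := by
  have h1 := (submatrix_mem_absolutelySeparable hσ e).2 _ bellRotation_mem
  have h2 := witness_nonneg_of_mem_separableStates r h1
  have h : ((√2)⁻¹ : ℝ) * (√2)⁻¹ = 1 / 2 := by
    rw [← mul_inv, Real.mul_self_sqrt (by norm_num)]; norm_num
  generalize hm : σ.submatrix e e = m at h2
  have hm' : ∀ i j, m i j = σ (e i) (e j) := fun i j => by rw [← hm]; rfl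
  simp only [← hm']
  simp [bellRotation, Matrix.mul_apply, Fintype.sum_prod_type, Fin.sum_univ_two,
      -Complex.ofReal_inv] at h2
  rw [← sub_nonneg] at h2 ⊢
  refine h2.trans_eq ?_
  linear_combination (2 * r * ((m (1, 0) (1, 0)).re - (m (0, 0) (0, 0)).re)) * h

/-- The unitary rotating the plane spanned by the basis vectors `|00⟩`, `|01⟩`. -/
def planeRotation (α β : ℂ) : Matrix (Fin 2 × Fin 2) (Fin 2 × Fin 2) ℂ :=
  Matrix.of fun a b =>
    if a.1 = 1 then (if a = b then 1 else 0)
    else if b.1 = 1 then 0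
    else if a.2 = 0 then (if b.2 = 0 then α else β)
    else (if b.2 = 0 then -star β else star α)

theorem planeRotation_mem {α β : ℂ} (h : Complex.normSq α + Complex.normSq β = 1) :
    planeRotation α β ∈ Matrix.unitaryGroup (Fin 2 × Fin 2) ℂ := by
  have h' : α * star α + β * star β = 1 := by
    simp only [Complex.star_def, Complex.mul_conj]; exact_mod_cast h
  have h2 : star β * β + star α * α = 1 := by rw [← h']; ring
  simp only [Complex.star_def] at h' h2
  rw [Matrix.mem_unitaryGroup_iff]
  ext ⟨a, b⟩ ⟨c, d⟩
  fin_cases a <;> fin_cases b <;> fin_cases c <;> fin_cases d <;>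
    simp [planeRotation, Matrix.mul_apply, Fintype.sum_prod_type, Fin.sum_univ_two,
      Matrix.star_apply, h', h2] <;> ring

theorem planeRotation_conj_diag {σ : Matrix (Fin 2 × Fin 2) (Fin 2 × Fin 2) ℂ}
    (hσ : σ.IsHermitian) (α β : ℂ) :
    ((planeRotation α β * σ * (planeRotation α β)ᴴ) (0, 0) (0, 0)).re =
      Complex.normSq α * (σ (0, 0) (0, 0)).re + Complex.normSq β * (σ (0, 1) (0, 1)).re
        + 2 * (α * star β * σ (0, 0) (0, 1)).re ∧
    ((planeRotation α β * σ * (planeRotation α β)ᴴ) (0, 1) (0, 1)).re =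
      Complex.normSq β * (σ (0, 0) (0, 0)).re + Complex.normSq α * (σ (0, 1) (0, 1)).re
        - 2 * (α * star β * σ (0, 0) (0, 1)).re ∧
    ((planeRotation α β * σ * (planeRotation α β)ᴴ) (1, 0) (1, 0)).re =
      (σ (1, 0) (1, 0)).re ∧
    ((planeRotation α β * σ * (planeRotation α β)ᴴ) (1, 1) (1, 1)).re =
      (σ (1, 1) (1, 1)).re := by
  have h := hσ.apply (0, 1) (0, 0)
  have h0 := congrArg Complex.im (hσ.apply (0, 0) (0, 0))
  have h1 := congrArg Complex.im (hσ.apply (0, 1) (0, 1))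
  simp only [Complex.star_def, Complex.conj_im] at h0 h1
  refine ⟨?_, ?_, ?_, ?_⟩ <;>
  simp [planeRotation, Matrix.mul_apply, Fintype.sum_prod_type, Fin.sum_univ_two, ← h,
    Complex.normSq_apply] <;> ring

theorem plane_inequalities_of_normalized {r : ℝ}
    {σ : Matrix (Fin 2 × Fin 2) (Fin 2 × Fin 2) ℂ}
    (hσ : σ ∈ absolutelySeparable (Fin 2) (Fin 2)) {α β : ℂ}
    (h : Complex.normSq α + Complex.normSq β = 1) {u v k l : ℝ}
    (hu : u = Complex.normSq α * (σ (0, 0) (0, 0)).re + Complex.normSq β * (σ (0, 1) (0, 1)).re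
        + 2 * (α * star β * σ (0, 0) (0, 1)).re)
    (hv : v = Complex.normSq β * (σ (0, 0) (0, 0)).re + Complex.normSq α * (σ (0, 1) (0, 1)).re
        - 2 * (α * star β * σ (0, 0) (0, 1)).re)
    (hk : k = (σ (1, 0) (1, 0)).re) (hl : l = (σ (1, 1) (1, 1)).re) :
    0 ≤ -r * u + v + r * k + r ^ 2 * l ∧ 0 ≤ -r * k + l + r * u + r ^ 2 * v ∧
      0 ≤ -r * u + k + r * v + r ^ 2 * l := by
  obtain ⟨h1, h2, h3, h4⟩ := planeRotation_conj_diag hσ.1.1.1 α β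
  have hA := conj_mem_absolutelySeparable hσ (planeRotation_mem h)
  rw [← h1] at hu
  rw [← h2] at hv
  rw [← h3] at hk
  rw [← h4] at hl
  subst hu hv hk hl
  refine ⟨diag_inequality hA 1, ?_, ?_⟩
  · exact diag_inequality hA
      ((Equiv.swap (0 : Fin 2) 1).prodCongr (Equiv.refl (Fin 2)))
  · exact diag_inequality hA (Equiv.prodComm (Fin 2) (Fin 2))

/-- The inequalities are homogeneous of degree two in `(α, β)`, so the normalization can be dropped
and convenient or large parameters inserted directly. -/
theorem plane_inequalities {r : ℝ} {σ : Matrix (Fin 2 × Fin 2) (Fin 2 × Fin 2) ℂ}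
    (hσ : σ ∈ absolutelySeparable (Fin 2) (Fin 2)) (α β : ℂ) {N u v k l : ℝ}
    (hN : N = Complex.normSq α + Complex.normSq β)
    (hu : u = Complex.normSq α * (σ (0, 0) (0, 0)).re + Complex.normSq β * (σ (0, 1) (0, 1)).re
        + 2 * (α * star β * σ (0, 0) (0, 1)).re)
    (hv : v = Complex.normSq β * (σ (0, 0) (0, 0)).re + Complex.normSq α * (σ (0, 1) (0, 1)).re
        - 2 * (α * star β * σ (0, 0) (0, 1)).re)
    (hk : k = N * (σ (1, 0) (1, 0)).re) (hl : l = N * (σ (1, 1) (1, 1)).re) :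
    0 ≤ -r * u + v + r * k + r ^ 2 * l ∧ 0 ≤ -r * k + l + r * u + r ^ 2 * v ∧
      0 ≤ -r * u + k + r * v + r ^ 2 * l := by
  have hα := Complex.normSq_nonneg α
  have hβ := Complex.normSq_nonneg β
  rcases (add_nonneg hα hβ).eq_or_lt with h0 | h0
  · have ha : α = 0 := Complex.normSq_eq_zero.1 (by linarith)
    have hb : β = 0 := Complex.normSq_eq_zero.1 (by linarith)
    subst ha hb
    simp at hN hu hv
    subst hN hu hv
    simp at hk hl
    subst hk hl
    simp
  · rw [← hN] at h0
    have hs : √N ^ 2 = N := Real.sq_sqrt h0.le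
    have hi : ((√N)⁻¹) ^ 2 = N⁻¹ := by rw [inv_pow, hs]
    have hi' : (√N)⁻¹ * (√N)⁻¹ = N⁻¹ := by rw [← sq, hi]
    have hNN : N⁻¹ * N = 1 := inv_mul_cancel₀ h0.ne'
    have e1 : ∀ z : ℂ, Complex.normSq (((√N)⁻¹ : ℝ) * z) = N⁻¹ * Complex.normSq z := fun z => by
      rw [Complex.normSq_mul, Complex.normSq_ofReal, hi']
    have e2 : ∀ z : ℂ, (((((√N)⁻¹ : ℝ) * α) * star (((√N)⁻¹ : ℝ) * β)) * z).re =
        N⁻¹ * (α * star β * z).re := fun z => by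
      rw [star_mul', Complex.star_def, Complex.conj_ofReal, ← hi', Complex.ofReal_inv]
      rw [show ((√N : ℂ)⁻¹ * α * ((√N : ℂ)⁻¹ * (starRingEnd ℂ) β) * z) =
        (((√N)⁻¹ * (√N)⁻¹ : ℝ) : ℂ) * (α * (starRingEnd ℂ) β * z) by push_cast; ring,
        Complex.re_ofReal_mul]
    have := plane_inequalities_of_normalized (r := r) hσ (α := ((√N)⁻¹ : ℝ) * α)
      (β := ((√N)⁻¹ : ℝ) * β) (u := N⁻¹ * u) (v := N⁻¹ * v) (k := N⁻¹ * k) (l := N⁻¹ * l)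
      (by rw [e1, e1, ← mul_add, ← hN, hNN]) (by rw [e1, e1, e2, hu]; ring)
      (by rw [e1, e1, e2, hv]; ring) (by rw [hk, ← mul_assoc, hNN, one_mul])
      (by rw [hl, ← mul_assoc, hNN, one_mul])
    have hp : 0 < N⁻¹ := inv_pos.2 h0
    refine ⟨?_, ?_, ?_⟩
    · refine nonneg_of_mul_nonneg_right (a := N⁻¹) ?_ hp; linarith [this.1]
    · refine nonneg_of_mul_nonneg_right (a := N⁻¹) ?_ hp; linarith [this.2.1]
    · refine nonneg_of_mul_nonneg_right (a := N⁻¹) ?_ hp; linarith [this.2.2]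

end FrameInequalities

/-! ### Rigidity of convex decompositions of the two-level state. -/

section Extremality

/-- The states with spectrum proportional to `(r², r², 1, 1)` when `r² = 2 r + 1`, diagonal in the
computational basis. -/
noncomputable def twoLevelState (r : ℝ) : Matrix (Fin 2 × Fin 2) (Fin 2 × Fin 2) ℂ :=
  Matrix.diagonal fun i => (((if i.1 = 0 then 2 * r + 1 else 1) / (4 * r + 4) : ℝ) : ℂ)

theorem eq_zero_of_convex_combination {s t a b : ℝ} (hs : 0 < s) (ht : 0 < t) (ha : 0 ≤ a)
    (hb : 0 ≤ b) (h : s * a + t * b = 0) : a = 0 := by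
  have h1 := mul_nonneg hs.le ha
  have h2 := mul_nonneg ht.le hb
  have h3 : s * a = 0 := by linarith
  exact (mul_eq_zero.1 h3).resolve_left hs.ne'

variable {r A s t : ℝ} {σ τ ρ : Matrix (Fin 2 × Fin 2) (Fin 2 × Fin 2) ℂ}

theorem re_combination (h : s • σ + t • τ = ρ) (i j : Fin 2 × Fin 2) (z : ℂ) :
    s * (z * σ i j).re + t * (z * τ i j).re = (z * ρ i j).re := by
  rw [← h]
  simp [mul_add]
  ring

/-- For `ρ` the inequality is an equality in every frame of the degenerate plane, because `r² = 2r +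
1`; nonnegativity transfers this to `σ`. As the weights `-r` and `1` in that plane differ, the block
of `σ` must be scalar. -/
theorem rigid_upper_plane (hr : 0 < r) (hrr : r ^ 2 = 2 * r + 1)
    (hσ : σ ∈ absolutelySeparable (Fin 2) (Fin 2)) (hτ : τ ∈ absolutelySeparable (Fin 2) (Fin 2))
    (hs : 0 < s) (ht : 0 < t) (h : s • σ + t • τ = ρ)
    (h0 : ρ (0, 0) (0, 0) = (A * r ^ 2 : ℝ)) (h1 : ρ (0, 1) (0, 1) = (A * r ^ 2 : ℝ))
    (h2 : ρ (1, 0) (1, 0) = A) (h3 : ρ (1, 1) (1, 1) = A) (h01 : ρ (0, 0) (0, 1) = 0) :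
    (σ (0, 0) (0, 0)).re = (σ (0, 1) (0, 1)).re ∧ σ (0, 0) (0, 1) = 0 ∧
      -r * (σ (0, 0) (0, 0)).re + (σ (0, 1) (0, 1)).re + r * (σ (1, 0) (1, 0)).re
        + r ^ 2 * (σ (1, 1) (1, 1)).re = 0 := by
  have key : ∀ α β : ℂ, -r * (Complex.normSq α * (σ (0, 0) (0, 0)).re
        + Complex.normSq β * (σ (0, 1) (0, 1)).re + 2 * (α * star β * σ (0, 0) (0, 1)).re)
      + (Complex.normSq β * (σ (0, 0) (0, 0)).re + Complex.normSq α * (σ (0, 1) (0, 1)).re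
        - 2 * (α * star β * σ (0, 0) (0, 1)).re)
      + r * ((Complex.normSq α + Complex.normSq β) * (σ (1, 0) (1, 0)).re)
      + r ^ 2 * ((Complex.normSq α + Complex.normSq β) * (σ (1, 1) (1, 1)).re) = 0 := by
    intro α β
    refine eq_zero_of_convex_combination hs ht (plane_inequalities (r := r) hσ α β rfl rfl rfl rfl rfl).1
      (plane_inequalities (r := r) hτ α β rfl rfl rfl rfl rfl).1 ?_
    have e0 := re_combination h (0, 0) (0, 0) 1
    have e1 := re_combination h (0, 1) (0, 1) 1
    have e2 := re_combination h (1, 0) (1, 0) 1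
    have e3 := re_combination h (1, 1) (1, 1) 1
    have e01 := re_combination h (0, 0) (0, 1) (α * star β)
    rw [h0] at e0; rw [h1] at e1; rw [h2] at e2; rw [h3] at e3; rw [h01] at e01
    simp only [one_mul, mul_zero, Complex.ofReal_re, Complex.zero_re] at e0 e1 e2 e3 e01
    set a := Complex.normSq α
    set b := Complex.normSq β
    linear_combination (-r * a + b) * e0 + (-r * b + a) * e1 + (-r * 2 - 2) * e01
      + r * (a + b) * e2 + r ^ 2 * (a + b) * e3 - A * r * (a + b) * hrr
  -- The first two choices compare the diagonal entries; the last two isolate the real and imaginary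
  -- parts of the off-diagonal one.
  have k1 := key 1 0
  have k2 := key 0 1
  have k3 := key 1 1
  have k4 := key 1 Complex.I
  simp at k1 k2 k3 k4
  have hx : (r + 1) * ((σ (0, 0) (0, 0)).re - (σ (0, 1) (0, 1)).re) = 0 := by linarith
  have hre : (r + 1) * (σ (0, 0) (0, 1)).re = 0 := by linarith
  have him : (r + 1) * (σ (0, 0) (0, 1)).im = 0 := by linarith
  have hr1 : r + 1 ≠ 0 := by positivity
  refine ⟨sub_eq_zero.1 ((mul_eq_zero.1 hx).resolve_left hr1),
    Complex.ext ((mul_eq_zero.1 hre).resolve_left hr1) ((mul_eq_zero.1 him).resolve_left hr1), ?_⟩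
  linarith

/-- The same argument for the eigenspace of the smaller eigenvalue, whose weights `r` and `r²`
differ since `r > 1`. -/
theorem rigid_lower_plane (hr : 1 < r) (hrr : r ^ 2 = 2 * r + 1)
    (hσ : σ ∈ absolutelySeparable (Fin 2) (Fin 2)) (hτ : τ ∈ absolutelySeparable (Fin 2) (Fin 2))
    (hs : 0 < s) (ht : 0 < t) (h : s • σ + t • τ = ρ)
    (h0 : ρ (1, 0) (1, 0) = (A * r ^ 2 : ℝ)) (h1 : ρ (1, 1) (1, 1) = (A * r ^ 2 : ℝ))
    (h2 : ρ (0, 0) (0, 0) = A) (h3 : ρ (0, 1) (0, 1) = A) (h01 : ρ (0, 0) (0, 1) = 0) :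
    (σ (0, 0) (0, 0)).re = (σ (0, 1) (0, 1)).re ∧ σ (0, 0) (0, 1) = 0 := by
  have key : ∀ α β : ℂ, -r * ((Complex.normSq α + Complex.normSq β) * (σ (1, 0) (1, 0)).re)
      + (Complex.normSq α + Complex.normSq β) * (σ (1, 1) (1, 1)).re
      + r * (Complex.normSq α * (σ (0, 0) (0, 0)).re
        + Complex.normSq β * (σ (0, 1) (0, 1)).re + 2 * (α * star β * σ (0, 0) (0, 1)).re)
      + r ^ 2 * (Complex.normSq β * (σ (0, 0) (0, 0)).re
        + Complex.normSq α * (σ (0, 1) (0, 1)).re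
        - 2 * (α * star β * σ (0, 0) (0, 1)).re) = 0 := by
    intro α β
    refine eq_zero_of_convex_combination hs ht (plane_inequalities (r := r) hσ α β rfl rfl rfl rfl rfl).2.1
      (plane_inequalities (r := r) hτ α β rfl rfl rfl rfl rfl).2.1 ?_
    have e0 := re_combination h (0, 0) (0, 0) 1
    have e1 := re_combination h (0, 1) (0, 1) 1
    have e2 := re_combination h (1, 0) (1, 0) 1
    have e3 := re_combination h (1, 1) (1, 1) 1
    have e01 := re_combination h (0, 0) (0, 1) (α * star β)
    rw [h2] at e0; rw [h3] at e1; rw [h0] at e2; rw [h1] at e3; rw [h01] at e01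
    simp only [one_mul, mul_zero, Complex.ofReal_re, Complex.zero_re] at e0 e1 e2 e3 e01
    set a := Complex.normSq α
    set b := Complex.normSq β
    linear_combination (r * a + r ^ 2 * b) * e0 + (r * b + r ^ 2 * a) * e1
      + (r * 2 - 2 * r ^ 2) * e01
      - r * (a + b) * e2 + (a + b) * e3 - A * r * (a + b) * hrr
  have k1 := key 1 0
  have k2 := key 0 1
  have k3 := key 1 1
  have k4 := key 1 Complex.I
  simp at k1 k2 k3 k4
  have hx : (r ^ 2 - r) * ((σ (0, 0) (0, 0)).re - (σ (0, 1) (0, 1)).re) = 0 := by linarith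
  have hre : (r ^ 2 - r) * (σ (0, 0) (0, 1)).re = 0 := by linarith
  have him : (r ^ 2 - r) * (σ (0, 0) (0, 1)).im = 0 := by linarith
  have hr1 : r ^ 2 - r ≠ 0 := by nlinarith
  exact ⟨sub_eq_zero.1 ((mul_eq_zero.1 hx).resolve_left hr1),
    Complex.ext ((mul_eq_zero.1 hre).resolve_left hr1) ((mul_eq_zero.1 him).resolve_left hr1)⟩

/-- A first variation argument: the nonnegative expression vanishes at the unrotated frame, so its
linear term under rotation, a multiple of the off-diagonal entry, must vanish. -/
theorem rigid_cross_plane (hr : 0 < r) (hσ : σ ∈ absolutelySeparable (Fin 2) (Fin 2))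
    (h : -r * (σ (0, 0) (0, 0)).re + (σ (1, 0) (1, 0)).re + r * (σ (0, 1) (0, 1)).re
        + r ^ 2 * (σ (1, 1) (1, 1)).re = 0) : σ (0, 0) (0, 1) = 0 := by
  set d := (σ (0, 0) (0, 0)).re - (σ (0, 1) (0, 1)).re with hd
  set z := σ (0, 0) (0, 1)
  -- Taking `β = z` aligns the phases, and `α = |d| + 1` is large enough for the negative linear
  -- term to beat the quadratic one.
  have h1 := (plane_inequalities (r := r) hσ ((|d| + 1 : ℝ) : ℂ) z rfl rfl rfl rfl rfl).2.2
  have h2 : (((|d| + 1 : ℝ) : ℂ) * star z * z).re = (|d| + 1) * Complex.normSq z := by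
    rw [mul_assoc, Complex.re_ofReal_mul, mul_comm (star z), Complex.star_def, Complex.mul_conj,
      Complex.ofReal_re]
  rw [h2, Complex.normSq_ofReal] at h1
  by_contra hne
  have hp : 0 < r * Complex.normSq z := mul_pos hr (Complex.normSq_pos.2 hne)
  have h3 : 0 ≤ (r * Complex.normSq z) * (2 * d - 4 * (|d| + 1)) := by
    linear_combination h1 + ((|d| + 1) ^ 2 + Complex.normSq z) * h + 2 * r * Complex.normSq z * hd
  have := nonneg_of_mul_nonneg_right h3 hp
  have := le_abs_self d
  have := abs_nonneg d
  linarith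

theorem eq_twoLevelState (hr : 1 < r) (hrr : r ^ 2 = 2 * r + 1)
    (hσ : σ ∈ absolutelySeparable (Fin 2) (Fin 2)) (hτ : τ ∈ absolutelySeparable (Fin 2) (Fin 2))
    (hs : 0 < s) (ht : 0 < t) (h : s • σ + t • τ = twoLevelState r) : σ = twoLevelState r := by
  have hr0 : 0 < r := by linarith
  have hr4 : 4 * r + 4 ≠ 0 := by positivity
  have hd0 : ∀ j, twoLevelState r (0, j) (0, j) = (1 / (4 * r + 4) * r ^ 2 : ℝ) := fun j => by
    rw [hrr]; simp [twoLevelState]; ring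
  have hd1 : ∀ j, twoLevelState r (1, j) (1, j) = (1 / (4 * r + 4) : ℝ) := fun j => by
    simp [twoLevelState]
  obtain ⟨p1, p2, p3⟩ := rigid_upper_plane hr0 hrr hσ hτ hs ht h
    (hd0 0) (hd0 1) (hd1 0) (hd1 1) (by simp [twoLevelState])
  let e : Equiv.Perm (Fin 2 × Fin 2) := (Equiv.swap (0 : Fin 2) 1).prodCongr (Equiv.refl (Fin 2))
  obtain ⟨q1, q2⟩ := rigid_lower_plane hr hrr
    (submatrix_mem_absolutelySeparable hσ e)
    (submatrix_mem_absolutelySeparable hτ e) hs ht (ρ := (twoLevelState r).submatrix e e)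
    (by rw [← h]; rfl) (hd0 0) (hd0 1) (hd1 0) (hd1 1) (by simp [twoLevelState, e])
  simp only [Matrix.submatrix_apply, e, Equiv.prodCongr_apply, Prod.map_apply,
    Equiv.swap_apply_left, Equiv.refl_apply] at q1 q2
  have hsum : ∀ (f : Fin 2 → ℝ) (j : Fin 2), f 0 = f 1 → f j = f 0 := fun f j hf => by
    fin_cases j <;> simp [hf]
  have x' : ∀ j, (σ (0, j) (0, j)).re = (σ (0, 0) (0, 0)).re :=
    fun j => hsum (fun j => (σ (0, j) (0, j)).re) j p1
  have y' : ∀ j, (σ (1, j) (1, j)).re = (σ (1, 0) (1, 0)).re :=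
    fun j => hsum (fun j => (σ (1, j) (1, j)).re) j q1
  have cross : ∀ a b : Fin 2, σ (0, a) (1, b) = 0 := by
    intro a b
    -- `g` sends `(0,0), (0,1)` to `(0,a), (1,b)`, so the entry `(0,a), (1,b)` becomes the one
    -- killed by `rigid_cross_plane`.
    let g : Equiv.Perm (Fin 2 × Fin 2) := (Equiv.prodComm (Fin 2) (Fin 2)).trans
      (Equiv.prodCongrRight fun j => Equiv.addRight (if j = 0 then a else b))
    have := rigid_cross_plane hr0 (submatrix_mem_absolutelySeparable hσ g) (by
      simp only [Matrix.submatrix_apply, g, Equiv.trans_apply, Equiv.prodComm_apply,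
        Prod.swap_prod_mk, Equiv.prodCongrRight_apply, x', y']
      rw [← p1, y' 1] at p3
      exact p3)
    simpa [g] using this
  have hH := hσ.1.1.1
  have low : ∀ i j, σ i j = 0 → σ j i = 0 := fun i j hij => by rw [← hH.apply, hij, star_zero]
  have him : ∀ i, (σ i i).im = 0 := fun i => by
    have := congrArg Complex.im (hH.apply i i)
    simp only [Complex.star_def, Complex.conj_im] at this
    linarith
  have htr := congrArg Complex.re hσ.1.2
  simp [Matrix.trace, Fintype.sum_prod_type, Fin.sum_univ_two] at htr
  rw [← p1, ← q1] at htr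
  rw [← p1, ← q1] at p3
  -- Saturation and unit trace are two independent linear equations for the two remaining diagonal
  -- values.
  have hy : (σ (1, 0) (1, 0)).re = 1 / (4 * r + 4) := by
    rw [eq_div_iff hr4]
    refine mul_left_cancel₀ (a := 2 * r) (by positivity) ?_
    linear_combination 2 * (r + 1) * p3 + (r + 1) * (r - 1) * htr
      - (2 * (r + 1) * (σ (1, 0) (1, 0)).re - 1) * hrr
  have hx : (σ (0, 0) (0, 0)).re = (2 * r + 1) / (4 * r + 4) := by
    rw [eq_div_iff hr4] at hy ⊢
    linear_combination (2 * r + 2) * htr - hy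
  have D0 : ∀ j, σ (0, j) (0, j) = (((2 * r + 1) / (4 * r + 4) : ℝ) : ℂ) := fun j =>
    Complex.ext (by rw [x', hx, Complex.ofReal_re]) (by rw [him, Complex.ofReal_im])
  have D1 : ∀ j, σ (1, j) (1, j) = ((1 / (4 * r + 4) : ℝ) : ℂ) := fun j =>
    Complex.ext (by rw [y', hy, Complex.ofReal_re]) (by rw [him, Complex.ofReal_im])
  ext ⟨a, b⟩ ⟨c, d⟩
  fin_cases a <;> fin_cases b <;> fin_cases c <;> fin_cases d <;>
    simp [twoLevelState, D0, D1, cross, low _ _ (cross _ _), p2, q2, low _ _ p2, low _ _ q2]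

end Extremality

/-! ### Separability from vectors of vanishing determinant. -/

section ProductVectors

theorem exists_eq_mul_of_det_eq_zero {y : Fin 2 × Fin 2 → ℂ}
    (hy : y (0, 0) * y (1, 1) = y (0, 1) * y (1, 0)) :
    ∃ a b : Fin 2 → ℂ, ∀ i, y i = a i.1 * b i.2 := by
  by_cases h0 : y (0, 0) = 0
  · by_cases h1 : y (0, 1) = 0
    · refine ⟨![0, 1], fun j => y (1, j), ?_⟩
      rintro ⟨i, j⟩
      fin_cases i <;> fin_cases j <;> simp [h0, h1]
    · have h2 : y (1, 0) = 0 := by simpa [h0, h1] using hy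
      refine ⟨fun i => y (i, 1), ![0, 1], ?_⟩
      rintro ⟨i, j⟩
      fin_cases i <;> fin_cases j <;> simp [h0, h2]
  · refine ⟨fun i => y (i, 0) / y (0, 0), fun j => y (0, j), ?_⟩
    rintro ⟨i, j⟩
    fin_cases i <;> fin_cases j <;> simp [h0]
    field_simp
    linear_combination hy

theorem sum_mul_star_eq_sum_normSq {ι : Type*} [Fintype ι] (a : ι → ℂ) :
    ∑ i, a i * star (a i) = ((∑ i, Complex.normSq (a i) : ℝ) : ℂ) := by
  push_cast
  exact Finset.sum_congr rfl fun i _ => Complex.mul_conj _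

theorem exists_state_smul_eq {ι : Type*} [Fintype ι] [Nonempty ι] (a : ι → ℂ) :
    ∃ ρ ∈ states ι, Matrix.vecMulVec a (star a) = (∑ i, Complex.normSq (a i)) • ρ := by
  classical
  set s := ∑ i, Complex.normSq (a i) with hs
  have hs0 : 0 ≤ s := Finset.sum_nonneg fun i _ => Complex.normSq_nonneg _
  rcases hs0.eq_or_lt with h | h
  · have ha : a = 0 := by
      funext i
      have := (Finset.sum_eq_zero_iff_of_nonneg fun i _ => Complex.normSq_nonneg (a i)).1
        (hs ▸ h.symm) i (Finset.mem_univ i)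
      exact Complex.normSq_eq_zero.1 this
    obtain ⟨i⟩ := ‹Nonempty ι›
    -- For `a = 0` the weight is zero and any state serves.
    refine ⟨Matrix.vecMulVec (Pi.single i 1) (star (Pi.single i 1)),
      ⟨Matrix.posSemidef_vecMulVec_self_star _, ?_⟩, ?_⟩
    · simp [Matrix.trace_vecMulVec]
    · rw [← h, ha]; simp
  · refine ⟨s⁻¹ • Matrix.vecMulVec a (star a),
      ⟨(Matrix.posSemidef_vecMulVec_self_star _).smul (inv_nonneg.2 hs0), ?_⟩, ?_⟩
    · rw [Matrix.trace_smul, Matrix.trace_vecMulVec]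
      have : a ⬝ᵥ star a = (s : ℂ) := sum_mul_star_eq_sum_normSq a
      rw [this, Complex.real_smul, ← Complex.ofReal_mul, inv_mul_cancel₀ h.ne', Complex.ofReal_one]
    · rw [smul_smul, mul_inv_cancel₀ h.ne', one_smul]

/-- A vector in `ℂ² ⊗ ℂ²` with zero determinant is a product vector; comparing traces shows that the
weights sum to `N`. -/
theorem mem_separableStates_of_sum_isotropic {κ : Type*} [Fintype κ] {N : ℝ} (hN : 0 < N)
    {τ : Matrix (Fin 2 × Fin 2) (Fin 2 × Fin 2) ℂ} (htr : τ.trace = 1)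
    (y : κ → Fin 2 × Fin 2 → ℂ) (hy : ∀ k, y k (0, 0) * y k (1, 1) = y k (0, 1) * y k (1, 0))
    (hτ : N • τ = ∑ k, Matrix.vecMulVec (y k) (star (y k))) :
    τ ∈ separableStates (Fin 2) (Fin 2) := by
  have h : ∀ k, ∃ w : ℝ, 0 ≤ w ∧ ∃ p ∈ productStates (Fin 2) (Fin 2), p.trace = 1 ∧
      Matrix.vecMulVec (y k) (star (y k)) = w • p := by
    intro k
    obtain ⟨a, b, hab⟩ := exists_eq_mul_of_det_eq_zero (hy k)
    obtain ⟨ρ, hρ, ha⟩ := exists_state_smul_eq a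
    obtain ⟨σ, hσ, hb⟩ := exists_state_smul_eq b
    refine ⟨(∑ i, Complex.normSq (a i)) * ∑ i, Complex.normSq (b i),
      mul_nonneg (Finset.sum_nonneg fun i _ => Complex.normSq_nonneg _)
        (Finset.sum_nonneg fun i _ => Complex.normSq_nonneg _), ρ ⊗ₖ σ, ⟨ρ, hρ, σ, hσ, rfl⟩, ?_, ?_⟩
    · rw [Matrix.trace_kronecker, hρ.2, hσ.2, one_mul]
    · rw [← smul_smul, ← Matrix.kronecker_smul, ← hb, ← Matrix.smul_kronecker, ← ha]
      ext i j
      simp [Matrix.vecMulVec_apply, hab]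
      ring
  choose w hw p hp hp1 hwp using h
  have hsum : N = ∑ k, w k := by
    have := congrArg Matrix.trace hτ
    simp only [hwp, Matrix.trace_smul, Matrix.trace_sum, htr, hp1] at this
    have := congrArg Complex.re this
    simpa using this
  have hconv : τ = ∑ k, (N⁻¹ * w k) • p k := by
    rw [← one_smul ℝ τ, ← inv_mul_cancel₀ hN.ne', ← smul_smul, hτ, Finset.smul_sum]
    exact Finset.sum_congr rfl fun k _ => by rw [hwp, smul_smul]
  rw [hconv]
  refine (convex_convexHull ℝ _).sum_mem (fun k _ => mul_nonneg (inv_nonneg.2 hN.le) (hw k)) ?_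
    fun k _ => subset_convexHull ℝ _ (hp k)
  rw [← Finset.mul_sum, ← hsum, inv_mul_cancel₀ hN.ne']

end ProductVectors

/-! ### Takagi diagonalization and rank one decompositions in dimension two. -/

section TwoDimensional

theorem exists_phase (ζ : ℂ) : ∃ η : ℂ, η * star η = 1 ∧ η ^ 2 * ζ = ‖ζ‖ := by
  by_cases h : ζ = 0
  · exact ⟨1, by simp, by simp [h]⟩
  · obtain ⟨η, hη⟩ := IsAlgClosed.exists_pow_nat_eq (star ζ / ‖ζ‖) (n := 2) (by norm_num)
    have hn : (‖ζ‖ : ℂ) ≠ 0 := by simpa using h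
    have h1 : ‖η‖ ^ 2 = 1 := by
      rw [← norm_pow, hη, norm_div, norm_star, Complex.norm_real, norm_norm, div_self (by simpa using h)]
    refine ⟨η, ?_, ?_⟩
    · rw [Complex.star_def, Complex.mul_conj, Complex.normSq_eq_norm_sq, h1, Complex.ofReal_one]
    · rw [hη, div_mul_eq_mul_div, div_eq_iff hn, Complex.star_def, mul_comm, Complex.mul_conj,
        Complex.normSq_eq_norm_sq]
      push_cast; ring

theorem exists_rotation (E F : ℝ) :
    ∃ p q : ℝ, p ^ 2 + q ^ 2 = 1 ∧ p * q * E + (p ^ 2 - q ^ 2) * F = 0 := by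
  -- The second equation is the vanishing of the imaginary part of `(p + iq)² (E/2 + iF)`.
  obtain ⟨η, h1, h2⟩ := exists_phase ⟨E / 2, F⟩
  refine ⟨η.re, η.im, ?_, ?_⟩
  · have := congrArg Complex.re h1
    simp at this
    linarith
  · have := congrArg Complex.im h2
    simp [pow_two] at this
    linarith

/-- The coefficients of a unitary congruence diagonalizing the complex symmetric matrix
`!![x, y; y, z]`, with real diagonal. -/
theorem exists_takagi_coefficients (x y z : ℂ) : ∃ a b c d : ℂ,
    a * star a + c * star c = 1 ∧ b * star b + d * star d = 1 ∧ a * star b + c * star d = 0 ∧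
    a * star a + b * star b = 1 ∧ c * star c + d * star d = 1 ∧ a * star c + b * star d = 0 ∧
    a * c * x + (a * d + b * c) * y + b * d * z = 0 ∧
    (a ^ 2 * x + 2 * a * b * y + b ^ 2 * z).im = 0 ∧
    (c ^ 2 * x + 2 * c * d * y + d ^ 2 * z).im = 0 := by
  -- The rows `(p, qη)` and `(-q, pη)` are to kill the off-diagonal entry. For `y ≠ 0`, `η` is
  -- chosen to make `(η² z - x) / (η y)` real, after which a real rotation suffices. Phases on the
  -- two rows later make the diagonal real.
  obtain ⟨η, p, q, hη, hpq, hoff⟩ : ∃ (η : ℂ) (p q : ℝ), η * star η = 1 ∧ p ^ 2 + q ^ 2 = 1 ∧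
      (p * q : ℂ) * (η ^ 2 * z - x) + ((p : ℂ) ^ 2 - q ^ 2) * (η * y) = 0 := by
    by_cases hy : y = 0
    · exact ⟨1, 1, 0, by simp, by simp, by simp [hy]⟩
    · obtain ⟨θ, hθ, hreal⟩ := exists_phase (star y * z + y * star x)
      have hη : θ ^ 2 * star (θ ^ 2) = 1 := by
        rw [star_pow, ← mul_pow, hθ, one_pow]
      set η := θ ^ 2
      have hyy : y * star y ≠ 0 := mul_ne_zero hy (star_ne_zero.2 hy)
      obtain ⟨κ, hκ⟩ : ∃ κ : ℝ, η ^ 2 * z - x = κ * (η * y) := by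
        have him : (star y * (η * z - star η * x)).im = 0 := by
          have := congrArg Complex.im hreal
          simp at this ⊢
          linarith
        refine ⟨(star y * (η * z - star η * x)).re / Complex.normSq y, ?_⟩
        have h3 : star y * (η * z - star η * x) = ((star y * (η * z - star η * x)).re : ℂ) :=
          Complex.ext rfl (by rw [him, Complex.ofReal_im])
        have h4 : (Complex.normSq y : ℂ) = y * star y := (Complex.mul_conj y).symm
        rw [Complex.ofReal_div, ← h3, h4]
        field_simp
        rw [eq_div_iff (by simp [hy])]
        linear_combination x * star y * hη
      obtain ⟨p, q, hpq, h0⟩ := exists_rotation κ 1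
      refine ⟨η, p, q, hη, hpq, ?_⟩
      rw [hκ]
      have h0' : (p : ℂ) * q * κ + (p ^ 2 - q ^ 2) * 1 = 0 := by exact_mod_cast h0
      linear_combination (η * y) * h0'
  have hpq' : (p : ℂ) ^ 2 + q ^ 2 = 1 := by exact_mod_cast hpq
  obtain ⟨θ, hθ, h1⟩ := exists_phase ((p : ℂ) ^ 2 * x + 2 * p * (q * η) * y + (q * η) ^ 2 * z)
  obtain ⟨φ, hφ, h2⟩ := exists_phase ((-q : ℂ) ^ 2 * x + 2 * (-q) * (p * η) * y + (p * η) ^ 2 * z)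
  have cp : star (p : ℂ) = p := Complex.conj_ofReal p
  have cq : star (q : ℂ) = q := Complex.conj_ofReal q
  refine ⟨θ * p, θ * (q * η), φ * (-q), φ * (p * η), ?_, ?_, ?_, ?_, ?_, ?_, ?_, ?_, ?_⟩
  all_goals try simp only [star_mul', star_neg, cp, cq]
  · linear_combination (p : ℂ) ^ 2 * hθ + (q : ℂ) ^ 2 * hφ + hpq'
  · linear_combination (q : ℂ) ^ 2 * η * star η * hθ + (p : ℂ) ^ 2 * η * star η * hφ
      + η * star η * hpq' + hη
  · linear_combination (p : ℂ) * q * star η * hθ - (p : ℂ) * q * star η * hφ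
  · linear_combination ((p : ℂ) ^ 2 + q ^ 2 * (η * star η)) * hθ + q ^ 2 * hη + hpq'
  · linear_combination ((q : ℂ) ^ 2 + p ^ 2 * (η * star η)) * hφ + p ^ 2 * hη + hpq'
  · linear_combination (θ * star φ) * p * q * hη
  · linear_combination θ * φ * hoff
  · have := congrArg Complex.im h1
    rw [Complex.ofReal_im] at this
    rw [← this]; congr 1; ring
  · have := congrArg Complex.im h2
    rw [Complex.ofReal_im] at this
    rw [← this]; congr 1; ring

/-- Any positive real matrix `1 + 2 r w wᵀ` with `‖w‖ = 1` is a sum of two rank one matrices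
`zz†` on each of which the form `z₀² - z₁²` takes the value `r`. -/
theorem exists_plane_decomposition {r : ℝ} (hr : 0 < r) (hrr : r ^ 2 = 2 * r + 1) {c s : ℝ}
    (hcs : c ^ 2 + s ^ 2 = 1) : ∃ P Q P' Q' : ℂ,
    P * star P + P' * star P' = 1 + 2 * r * c ^ 2 ∧ Q * star Q + Q' * star Q' = 1 + 2 * r * s ^ 2 ∧
    P * star Q + P' * star Q' = 2 * r * c * s ∧ P ^ 2 - Q ^ 2 = r ∧ P' ^ 2 - Q' ^ 2 = r := by
  -- Since `1 + 2r = r²`, the columns `r w` and `w⊥` give a real square root; rotating them makes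
  -- them orthogonal for the indefinite form.
  obtain ⟨a, b, a', b', ha, hb, hab, horth⟩ : ∃ a b a' b' : ℝ, a ^ 2 + a' ^ 2 = 1 + 2 * r * c ^ 2 ∧
      b ^ 2 + b' ^ 2 = 1 + 2 * r * s ^ 2 ∧ a * b + a' * b' = 2 * r * c * s ∧
      a * a' - b * b' = 0 := by
    obtain ⟨p, q, hpq, h⟩ := exists_rotation ((s ^ 2 - c ^ 2) - r ^ 2 * (c ^ 2 - s ^ 2))
      (-2 * r * c * s)
    refine ⟨p * (r * c) - q * s, p * (r * s) + q * c, -q * (r * c) - p * s, -q * (r * s) + p * c,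
      ?_, ?_, ?_, ?_⟩
    · linear_combination (r ^ 2 * c ^ 2 + s ^ 2) * hpq + c ^ 2 * hrr + hcs
    · linear_combination (r ^ 2 * s ^ 2 + c ^ 2) * hpq + s ^ 2 * hrr + hcs
    · linear_combination (r ^ 2 * c * s - c * s) * hpq + c * s * hrr
    · linear_combination h
  set C := c ^ 2 - s ^ 2 with hC
  have hCS : C ^ 2 + (2 * c * s) ^ 2 = 1 := by
    rw [hC]; linear_combination (c ^ 2 + s ^ 2 + 1) * hcs
  have hsum : (a ^ 2 - b ^ 2) + (a' ^ 2 - b' ^ 2) = 2 * r * C := by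
    rw [hC]; linear_combination ha - hb
  have hprod : (a ^ 2 - b ^ 2) * (a' ^ 2 - b' ^ 2) = -r ^ 2 := by
    linear_combination (a * a' - b * b') * horth - (b ^ 2 + b' ^ 2) * ha
      - (1 + 2 * r * c ^ 2) * hb + (a * b + a' * b' + 2 * r * c * s) * hab - 2 * r * hcs + hrr
  -- With `m = a² - b²` and `m' = a'² - b'²`, the form takes the value `ν = (m + e² m') / 2` on both
  -- `(a ± e a', b ± e b') / √2`. From `m + m' = 2rC` and `m m' = -r²`, this phase `e` gives `|ν| =
  -- r`; a final phase `η` turns `ν` into `r`.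
  set e : ℂ := ⟨C, 2 * c * s⟩ with he
  have hee : e * star e = 1 := by
    apply Complex.ext
    · simp [he]; linarith
    · simp [he]; ring
  set ν : ℂ := ((a ^ 2 - b ^ 2 : ℝ) + e ^ 2 * (a' ^ 2 - b' ^ 2 : ℝ)) / 2 with hν
  have hnorm : ‖ν‖ = r := by
    have hre : ν.re = ((a ^ 2 - b ^ 2) + (C ^ 2 - (2 * c * s) ^ 2) * (a' ^ 2 - b' ^ 2)) / 2 := by
      rw [hν, ← Complex.ofReal_ofNat, Complex.div_ofReal_re, Complex.add_re, Complex.ofReal_re,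
        Complex.re_mul_ofReal, pow_two e, Complex.mul_re, he]
      ring
    have him : ν.im = (2 * C * (2 * c * s) * (a' ^ 2 - b' ^ 2)) / 2 := by
      rw [hν, ← Complex.ofReal_ofNat, Complex.div_ofReal_im, Complex.add_im, Complex.ofReal_im,
        Complex.im_mul_ofReal, pow_two e, Complex.mul_im, he]
      ring
    have h2 : ‖ν‖ ^ 2 = r ^ 2 := by
      rw [Complex.sq_norm, Complex.normSq_apply, hre, him]
      generalize a ^ 2 - b ^ 2 = m at hsum hprod
      generalize a' ^ 2 - b' ^ 2 = m' at hsum hprod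
      generalize 2 * c * s = S at hCS
      clear_value C
      linear_combination (m' ^ 2 * (C ^ 2 + S ^ 2 + 1) / 4 - m * m' / 2) * hCS
        + (m + m' + 2 * r * C) / 4 * hsum + (C ^ 2 - 1) * hprod
    exact (pow_left_inj₀ (norm_nonneg _) hr.le two_ne_zero).1 h2
  obtain ⟨η, hη, h⟩ := exists_phase ν
  rw [hnorm] at h
  have hh : (((√2)⁻¹ : ℝ) : ℂ) ^ 2 = 1 / 2 := by
    rw [← Complex.ofReal_pow, inv_pow, Real.sq_sqrt (by norm_num)]; norm_num
  have ch : star (((√2)⁻¹ : ℝ) : ℂ) = ((√2)⁻¹ : ℝ) := Complex.conj_ofReal _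
  generalize (((√2)⁻¹ : ℝ) : ℂ) = g at hh ch
  have cc : ∀ x : ℝ, star (x : ℂ) = x := Complex.conj_ofReal
  have haC : (a : ℂ) ^ 2 + a' ^ 2 = 1 + 2 * r * c ^ 2 := by exact_mod_cast ha
  have hbC : (b : ℂ) ^ 2 + b' ^ 2 = 1 + 2 * r * s ^ 2 := by exact_mod_cast hb
  have habC : (a : ℂ) * b + a' * b' = 2 * r * c * s := by exact_mod_cast hab
  have horC : (a : ℂ) * a' - b * b' = 0 := by exact_mod_cast horth
  have hνC : ν = ((a ^ 2 - b ^ 2) + e ^ 2 * (a' ^ 2 - b' ^ 2)) / 2 := by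
    rw [hν]; push_cast; ring
  clear_value e ν
  refine ⟨g * η * (a + e * a'), g * η * (b + e * b'), g * η * (a - e * a'), g * η * (b - e * b'),
    ?_, ?_, ?_, ?_, ?_⟩
  all_goals try simp only [star_mul', star_add, star_sub, cc, ch]
  · linear_combination (2 * g ^ 2 * (a ^ 2 + e * star e * a' ^ 2)) * hη
      + (2 * g ^ 2 * a' ^ 2) * hee + 2 * (a ^ 2 + a' ^ 2) * hh + haC
  · linear_combination (2 * g ^ 2 * (b ^ 2 + e * star e * b' ^ 2)) * hη
      + (2 * g ^ 2 * b' ^ 2) * hee + 2 * (b ^ 2 + b' ^ 2) * hh + hbC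
  · linear_combination (2 * g ^ 2 * (a * b + e * star e * (a' * b'))) * hη
      + (2 * g ^ 2 * (a' * b')) * hee + 2 * (a * b + a' * b') * hh + habC
  · rw [hνC] at h
    linear_combination h + η ^ 2 * ((a + e * a') ^ 2 - (b + e * b') ^ 2) * hh + η ^ 2 * e * horC
  · rw [hνC] at h
    linear_combination h + η ^ 2 * ((a - e * a') ^ 2 - (b - e * b') ^ 2) * hh - η ^ 2 * e * horC

end TwoDimensional

/-! ### Real frames adapted to a complex two-plane in `ℂ⁴`. -/

section RealStructure

theorem exists_takagi_pair {ι : Type*} [Fintype ι] {v₁ v₂ : ι → ℂ} (h11 : v₁ ⬝ᵥ star v₁ = 1)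
    (h22 : v₂ ⬝ᵥ star v₂ = 1) (h12 : v₁ ⬝ᵥ star v₂ = 0) : ∃ w₁ w₂ : ι → ℂ,
    w₁ ⬝ᵥ star w₁ = 1 ∧ w₂ ⬝ᵥ star w₂ = 1 ∧ w₁ ⬝ᵥ star w₂ = 0 ∧
    w₁ ⬝ᵥ w₂ = 0 ∧ (w₁ ⬝ᵥ w₁).im = 0 ∧ (w₂ ⬝ᵥ w₂).im = 0 ∧
    ∀ i j, w₁ i * star (w₁ j) + w₂ i * star (w₂ j) = v₁ i * star (v₁ j) + v₂ i * star (v₂ j) := by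
  obtain ⟨a, b, c, d, k1, k2, k3, k4, k5, k6, k7, k8, k9⟩ :=
    exists_takagi_coefficients (v₁ ⬝ᵥ v₁) (v₁ ⬝ᵥ v₂) (v₂ ⬝ᵥ v₂)
  have h21 : v₂ ⬝ᵥ star v₁ = 0 := by
    have := congrArg star h12
    simpa [dotProduct, mul_comm] using this
  have hs : v₂ ⬝ᵥ v₁ = v₁ ⬝ᵥ v₂ := dotProduct_comm _ _
  refine ⟨a • v₁ + b • v₂, c • v₁ + d • v₂, ?_, ?_, ?_, ?_, ?_, ?_, ?_⟩
  all_goals simp only [star_add, star_smul, add_dotProduct, dotProduct_add, smul_dotProduct,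
    dotProduct_smul, h11, h22, h12, h21, hs, smul_eq_mul, Pi.add_apply, Pi.smul_apply, star_mul']
  · linear_combination k4
  · linear_combination k5
  · linear_combination k6
  · linear_combination k7
  · rw [← k8]; congr 1; ring
  · rw [← k9]; congr 1; ring
  · intro i j
    have k3' : star a * b + star c * d = 0 := by
      have := congrArg star k3
      simpa [mul_comm] using this
    linear_combination v₁ i * star (v₁ j) * k1 + v₂ i * star (v₂ j) * k2
      + v₁ i * star (v₂ j) * k3 + v₂ i * star (v₁ j) * k3'

/-- Zero vectors are allowed, because the real or imaginary part of a Takagi vector may vanish; the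
basis is completed at those indices. -/
theorem exists_orthonormalBasis_of_pairwise_orthogonal {ι E : Type*} [Fintype ι]
    [NormedAddCommGroup E] [InnerProductSpace ℝ E] [FiniteDimensional ℝ E]
    (hcard : Module.finrank ℝ E = Fintype.card ι) (g : ι → E)
    (hg : Pairwise fun i j => inner ℝ (g i) (g j) = 0) :
    ∃ b : OrthonormalBasis ι ℝ E, ∀ i, g i = ‖g i‖ • b i := by
  obtain ⟨b, hb⟩ := Orthonormal.exists_orthonormalBasis_extension_of_card_eq hcard
    (v := fun i => ‖g i‖⁻¹ • g i) (s := {i | g i ≠ 0}) (by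
      refine ⟨fun i => ?_, fun i j hij => ?_⟩
      · have : ‖g i‖ ≠ 0 := norm_ne_zero_iff.2 i.2
        simp [Set.domRestrict, norm_smul, this]
      · have : (i : ι) ≠ j := fun h => hij (Subtype.ext h)
        simp [Set.domRestrict, inner_smul_left, inner_smul_right, hg this])
  refine ⟨b, fun i => ?_⟩
  by_cases h : g i = 0
  · simp [h]
  · rw [hb i h, smul_smul, mul_inv_cancel₀ (norm_ne_zero_iff.2 h), one_smul]

/-- An orthonormal pair in `ℂ⁴` that is also orthogonal for the complex bilinear dot product is
real up to one phase in each plane of a real orthonormal basis. -/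
theorem exists_real_frame {w₁ w₂ : Fin 4 → ℂ} (h11 : w₁ ⬝ᵥ star w₁ = 1)
    (h22 : w₂ ⬝ᵥ star w₂ = 1) (h12 : w₁ ⬝ᵥ star w₂ = 0) (b12 : w₁ ⬝ᵥ w₂ = 0)
    (b11 : (w₁ ⬝ᵥ w₁).im = 0) (b22 : (w₂ ⬝ᵥ w₂).im = 0) :
    ∃ (f : Fin 4 → Fin 4 → ℝ) (c s c' s' : ℝ), c ^ 2 + s ^ 2 = 1 ∧ c' ^ 2 + s' ^ 2 = 1 ∧
      (∀ m n, f m ⬝ᵥ f n = if m = n then 1 else 0) ∧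
      (∀ i j, ∑ m, f m i * f m j = if i = j then 1 else 0) ∧
      (∀ i, w₁ i = c * f 0 i + Complex.I * (s * f 1 i)) ∧
      (∀ i, w₂ i = c' * f 2 i + Complex.I * (s' * f 3 i)) := by
  -- Orthogonality for both the Hermitian and the bilinear pairing, with real squares, says exactly
  -- that these four real vectors are pairwise orthogonal.
  let g : Fin 4 → EuclideanSpace ℝ (Fin 4) := ![WithLp.toLp 2 fun i => (w₁ i).re,
    WithLp.toLp 2 fun i => (w₁ i).im, WithLp.toLp 2 fun i => (w₂ i).re,
    WithLp.toLp 2 fun i => (w₂ i).im]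
  have hr := congrArg Complex.re h12
  have hi := congrArg Complex.im h12
  have hr' := congrArg Complex.re b12
  have hi' := congrArg Complex.im b12
  have n1 := congrArg Complex.re h11
  have n2 := congrArg Complex.re h22
  simp [dotProduct, Fin.sum_univ_four] at hr hi hr' hi' b11 b22 n1 n2
  obtain ⟨b, hb⟩ := exists_orthonormalBasis_of_pairwise_orthogonal (by simp) g (by
    intro i j hij
    fin_cases i <;> fin_cases j <;> first | exact absurd rfl hij | skip
    all_goals simp [g, PiLp.inner_apply, Fin.sum_univ_four]
    all_goals linarith)
  have hn : ∀ i, ‖g i‖ ^ 2 = ∑ k, g i k ^ 2 := fun i => by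
    rw [EuclideanSpace.norm_sq_eq]; simp
  have hgi : ∀ i k, g i k = ‖g i‖ * b i k := fun i k => by
    conv_lhs => rw [hb i]
    simp
  refine ⟨fun m i => b m i, ‖g 0‖, ‖g 1‖, ‖g 2‖, ‖g 3‖, ?_, ?_, ?_, ?_, ?_, ?_⟩
  · rw [hn, hn]; simp [g, Fin.sum_univ_four]; linarith
  · rw [hn, hn]; simp [g, Fin.sum_univ_four]; linarith
  · intro m n
    have := orthonormal_iff_ite.1 b.orthonormal m n
    rw [← this, PiLp.inner_apply]
    simp [dotProduct, mul_comm]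
  · intro i j
    have := b.sum_inner_mul_inner (EuclideanSpace.single i 1) (EuclideanSpace.single j 1)
    simpa [eq_comm, EuclideanSpace.inner_single_left, EuclideanSpace.inner_single_right] using this.symm
  · intro i
    have h0 := hgi 0 i
    have h1 := hgi 1 i
    apply Complex.ext
    · simpa [g] using h0
    · simpa [g] using h1
  · intro i
    have h0 := hgi 2 i
    have h1 := hgi 3 i
    apply Complex.ext
    · simpa [g] using h0
    · simpa [g] using h1

end RealStructure

/-! ### Decomposition of `1 + 2r P` into isotropic rank one terms. -/

section IsotropicDecomposition

theorem exists_isotropic_decomposition {r : ℝ} (hr : 0 < r) (hrr : r ^ 2 = 2 * r + 1)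
    {v₁ v₂ : Fin 4 → ℂ} (h11 : v₁ ⬝ᵥ star v₁ = 1)
    (h22 : v₂ ⬝ᵥ star v₂ = 1) (h12 : v₁ ⬝ᵥ star v₂ = 0) :
    ∃ z : Fin 4 → Fin 4 → ℂ, (∀ k, z k ⬝ᵥ z k = 0) ∧
      ∑ k, Matrix.vecMulVec (z k) (star (z k)) = 1 + (2 * r) •
        (Matrix.vecMulVec v₁ (star v₁) + Matrix.vecMulVec v₂ (star v₂)) := by
  obtain ⟨w₁, w₂, k11, k22, k12, b12, b11, b22, hw⟩ := exists_takagi_pair h11 h22 h12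
  obtain ⟨f, c, s, c', s', hcs, hcs', horth, hcomp, hw1, hw2⟩ :=
    exists_real_frame k11 k22 k12 b12 b11 b22
  obtain ⟨P₁, Q₁, P₂, Q₂, e1, e2, e3, e4, e5⟩ := exists_plane_decomposition hr hrr hcs
  obtain ⟨R₁, S₁, R₂, S₂, d1, d2, d3, d4, d5⟩ := exists_plane_decomposition hr hrr hcs'
  have e3' : Q₁ * star P₁ + Q₂ * star P₂ = 2 * r * c * s := by
    have := congrArg star e3
    simp at this
    simp only [Complex.star_def]
    linear_combination this
  have d3' : S₁ * star R₁ + S₂ * star R₂ = 2 * r * c' * s' := by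
    have := congrArg star d3
    simp at this
    simp only [Complex.star_def]
    linear_combination this
  let F : Fin 4 → Fin 4 → ℂ := fun m i => f m i
  have hF : ∀ m n, F m ⬝ᵥ F n = if m = n then 1 else 0 := fun m n => by
    have := congrArg (fun x : ℝ => (x : ℂ)) (horth m n)
    simp only [dotProduct] at this ⊢
    push_cast at this
    simpa [F, apply_ite] using this
  have hC : ∀ i j, ∑ m, F m i * F m j = if i = j then 1 else 0 := fun i j => by
    have := congrArg (fun x : ℝ => (x : ℂ)) (hcomp i j)
    push_cast at this
    simpa [F, apply_ite] using this
  have hFs : ∀ m, star (F m) = F m := fun m => by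
    funext i; exact Complex.conj_ofReal _
  have hh : (((√2)⁻¹ : ℝ) : ℂ) ^ 2 = 1 / 2 := by
    rw [← Complex.ofReal_pow, inv_pow, Real.sq_sqrt (by norm_num)]; norm_num
  have ch : star (((√2)⁻¹ : ℝ) : ℂ) = ((√2)⁻¹ : ℝ) := Complex.conj_ofReal _
  generalize (((√2)⁻¹ : ℝ) : ℂ) = g at hh ch
  have hI : Complex.I ^ 2 = -1 := Complex.I_sq
  have cI : star Complex.I = -Complex.I := Complex.conj_I
  let u : ℂ → ℂ → Fin 4 → ℂ := fun P Q => P • F 0 + (Complex.I * Q) • F 1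
  let t : ℂ → ℂ → Fin 4 → ℂ := fun R S => R • F 2 + (Complex.I * S) • F 3
  have huu : ∀ P Q, u P Q ⬝ᵥ u P Q = P ^ 2 - Q ^ 2 := fun P Q => by
    simp [u, hF]
    linear_combination Q ^ 2 * hI
  have htt : ∀ R S, t R S ⬝ᵥ t R S = R ^ 2 - S ^ 2 := fun R S => by
    simp [t, hF]
    linear_combination S ^ 2 * hI
  have hut : ∀ P Q R S, u P Q ⬝ᵥ t R S = 0 := fun P Q R S => by
    simp [u, t, hF]
  have iso : ∀ P Q R S : ℂ, P ^ 2 - Q ^ 2 = r → R ^ 2 - S ^ 2 = r → ∀ τ : ℂ, τ ^ 2 = -1 →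
      (g • (u P Q + τ • t R S)) ⬝ᵥ (g • (u P Q + τ • t R S)) = 0 := by
    intro P Q R S hPQ hRS τ hτ
    simp only [add_dotProduct, dotProduct_add, smul_dotProduct, dotProduct_smul, huu, htt, hut,
      dotProduct_comm (t R S) (u P Q), smul_eq_mul, hPQ, hRS]
    linear_combination g ^ 2 * r * hτ
  -- The form takes the value `r` on `u` and on `t`, so it vanishes on `u ± i t`; summing over the
  -- sign cancels the mixed terms in the outer products.
  refine ⟨![g • (u P₁ Q₁ + Complex.I • t R₁ S₁), g • (u P₁ Q₁ + (-Complex.I) • t R₁ S₁),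
    g • (u P₂ Q₂ + Complex.I • t R₂ S₂), g • (u P₂ Q₂ + (-Complex.I) • t R₂ S₂)], ?_, ?_⟩
  · have hI' : (-Complex.I) ^ 2 = -1 := by rw [neg_sq, hI]
    intro k
    fin_cases k
    · exact iso _ _ _ _ e4 d4 _ hI
    · exact iso _ _ _ _ e4 d4 _ hI'
    · exact iso _ _ _ _ e5 d5 _ hI
    · exact iso _ _ _ _ e5 d5 _ hI'
  · ext i j
    have cc : ∀ x : ℝ, star (x : ℂ) = x := Complex.conj_ofReal
    have cF : ∀ m i, star (F m i) = F m i := fun m i => Complex.conj_ofReal _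
    have outer : ∀ x y x' y' : ℂ, g * (x + Complex.I * y) * (g * (x' + -Complex.I * y'))
        + g * (x + -Complex.I * y) * (g * (x' + Complex.I * y')) = x * x' + y * y' :=
      fun x y x' y' => by
        linear_combination 2 * (x * x' + y * y') * hh - 2 * g ^ 2 * y * y' * hI
    have inner : ∀ P Q P' Q' x y x' y' : ℂ,
        (P * x + Complex.I * Q * y) * (P' * x' + -Complex.I * Q' * y') =
        P * P' * (x * x') + Q * Q' * (y * y') + Complex.I * (Q * P' * (y * x') - P * Q' * (x * y')) :=
      fun P Q P' Q' x y x' y' => by linear_combination -(Q * Q' * (y * y')) * hI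
    have hwij := hw i j
    have hCij := hC i j
    rw [hw1, hw1, hw2, hw2] at hwij
    simp only [Fin.sum_univ_four] at hCij
    have houter : ∀ P Q R S, (g • (u P Q + Complex.I • t R S)) i
          * star ((g • (u P Q + Complex.I • t R S)) j)
        + (g • (u P Q + (-Complex.I) • t R S)) i * star ((g • (u P Q + (-Complex.I) • t R S)) j)
        = (P * star P * (F 0 i * F 0 j) + Q * star Q * (F 1 i * F 1 j)
          + Complex.I * (Q * star P * (F 1 i * F 0 j) - P * star Q * (F 0 i * F 1 j)))
        + (R * star R * (F 2 i * F 2 j) + S * star S * (F 3 i * F 3 j)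
          + Complex.I * (S * star R * (F 3 i * F 2 j) - R * star S * (F 2 i * F 3 j))) :=
      fun P Q R S => by
        simp only [u, t, Pi.smul_apply, Pi.add_apply, smul_eq_mul, star_add, star_mul', star_neg,
          cF, cI, ch, neg_neg]
        rw [outer, inner, inner]
    simp only [star_add, star_mul', cc, cI] at hwij
    change _ = _ + ((2 * r : ℝ) : ℂ) * (v₁ i * star (v₁ j) + v₂ i * star (v₂ j))
    rw [← hwij, Matrix.one_apply, ← hCij]
    have hsum := congrArg₂ (· + ·) (houter P₁ Q₁ R₁ S₁) (houter P₂ Q₂ R₂ S₂)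
    rw [Matrix.sum_apply, Fin.sum_univ_four]
    refine (Eq.trans ?_ hsum).trans ?_
    · exact (add_assoc _ _ _)
    · push_cast
      change _ = _ + 2 * (r : ℂ) * ((c * F 0 i + Complex.I * (s * F 1 i)) *
        (c * F 0 j + -Complex.I * (s * F 1 j)) + (c' * F 2 i + Complex.I * (s' * F 3 i)) *
        (c' * F 2 j + -Complex.I * (s' * F 3 j)))
      linear_combination F 0 i * F 0 j * e1 + F 1 i * F 1 j * e2 + F 2 i * F 2 j * d1
        + F 3 i * F 3 j * d2 + Complex.I * F 1 i * F 0 j * e3' - Complex.I * F 0 i * F 1 j * e3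
        + Complex.I * F 3 i * F 2 j * d3' - Complex.I * F 2 i * F 3 j * d3
        + 2 * r * (s ^ 2 * F 1 i * F 1 j + s' ^ 2 * F 3 i * F 3 j) * hI

end IsotropicDecomposition

/-! ### Absolute separability of the two-level state via the magic basis. -/

section AbsoluteSeparability

/-- The magic basis of two qubits (as columns): it turns the determinant of a `2 × 2` matrix into
half of the standard quadratic form on `ℂ⁴`. -/
noncomputable def magicBasis : Matrix (Fin 2 × Fin 2) (Fin 4) ℂ :=
  Matrix.of fun a => (((√2)⁻¹ : ℝ) : ℂ) •
    if a = (0, 0) then ![1, Complex.I, 0, 0] else if a = (0, 1) then ![0, 0, 1, Complex.I]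
    else if a = (1, 0) then ![0, 0, -1, Complex.I] else ![1, -Complex.I, 0, 0]

theorem inv_sqrt_two_mul_self : (((√2)⁻¹ : ℝ) : ℂ) * (((√2)⁻¹ : ℝ) : ℂ) = 1 / 2 := by
  rw [← Complex.ofReal_mul, ← mul_inv, Real.mul_self_sqrt (by norm_num)]; norm_num

theorem magicBasis_mul_conjTranspose : magicBasis * magicBasisᴴ = 1 := by
  have h := inv_sqrt_two_mul_self
  have hI := Complex.I_mul_I
  have ch : (starRingEnd ℂ) (((√2)⁻¹ : ℝ) : ℂ) = ((√2)⁻¹ : ℝ) := Complex.conj_ofReal _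
  unfold magicBasis
  generalize (((√2)⁻¹ : ℝ) : ℂ) = g at h ch
  ext ⟨a, b⟩ ⟨c, d⟩
  fin_cases a <;> fin_cases b <;> fin_cases c <;> fin_cases d <;>
    simp [Matrix.mul_apply, Fin.sum_univ_four, ch] <;> grind

theorem magicBasis_isotropic {z : Fin 4 → ℂ} (hz : z ⬝ᵥ z = 0) :
    (magicBasis *ᵥ z) (0, 0) * (magicBasis *ᵥ z) (1, 1) =
      (magicBasis *ᵥ z) (0, 1) * (magicBasis *ᵥ z) (1, 0) := by
  simp [dotProduct, Fin.sum_univ_four] at hz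
  simp [magicBasis, Matrix.mulVec, dotProduct, Fin.sum_univ_four, -Complex.ofReal_inv]
  linear_combination (((√2)⁻¹ : ℝ) : ℂ) ^ 2 * hz
    - (((√2)⁻¹ : ℝ) : ℂ) ^ 2 * (z 1 ^ 2 + z 3 ^ 2) * Complex.I_sq

theorem mul_vecMulVec_star_mul {m n : Type*} [Fintype m] [Fintype n] (E : Matrix m n ℂ)
    (x : n → ℂ) : E * Matrix.vecMulVec x (star x) * Eᴴ =
      Matrix.vecMulVec (E *ᵥ x) (star (E *ᵥ x)) := by
  rw [Matrix.mul_vecMulVec, Matrix.vecMulVec_mul, Matrix.star_mulVec]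

theorem twoLevelState_mem_states {r : ℝ} (hr : 0 < r) :
    twoLevelState r ∈ states (Fin 2 × Fin 2) := by
  refine ⟨?_, ?_⟩
  · refine Matrix.posSemidef_diagonal_iff.2 fun i => ?_
    rw [Complex.zero_le_real]
    split_ifs <;> positivity
  · have h : (4 * r + 4 : ℂ) ≠ 0 := by
      have : (4 * r + 4 : ℝ) ≠ 0 := by positivity
      exact_mod_cast this
    simp [twoLevelState, Matrix.trace, Fintype.sum_prod_type]
    field_simp
    ring

theorem conj_twoLevelState {r : ℝ} (hr : 0 < r) {U : Matrix (Fin 2 × Fin 2) (Fin 2 × Fin 2) ℂ}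
    (hU : U ∈ Matrix.unitaryGroup (Fin 2 × Fin 2) ℂ) :
    (4 * r + 4) • (U * twoLevelState r * Uᴴ) = 1 + (2 * r) •
      (Matrix.vecMulVec (fun i => U i (0, 0)) (star fun i => U i (0, 0))
        + Matrix.vecMulVec (fun i => U i (0, 1)) (star fun i => U i (0, 1))) := by
  have h : (4 * r + 4 : ℂ) ≠ 0 := by
    have : (4 * r + 4 : ℝ) ≠ 0 := by positivity
    exact_mod_cast this
  rw [← Matrix.mem_unitaryGroup_iff.1 hU]
  ext i j
  simp [twoLevelState, Matrix.mul_apply, Fintype.sum_prod_type, Matrix.vecMulVec_apply,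
    Matrix.diagonal_apply, Matrix.star_apply]
  field_simp
  ring

theorem twoLevelState_mem_absolutelySeparable {r : ℝ} (hr : 0 < r) (hrr : r ^ 2 = 2 * r + 1) :
    twoLevelState r ∈ absolutelySeparable (Fin 2) (Fin 2) := by
  refine ⟨twoLevelState_mem_states hr, fun U hU => ?_⟩
  let v : Fin 2 → Fin 4 → ℂ := fun j => magicBasisᴴ *ᵥ fun i => U i (0, j)
  have hv : ∀ j, magicBasis *ᵥ v j = fun i => U i (0, j) := fun j => by
    rw [Matrix.mulVec_mulVec, magicBasis_mul_conjTranspose, Matrix.one_mulVec]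
  have horth : ∀ j k, v j ⬝ᵥ star (v k) = if j = k then 1 else 0 := fun j k => by
    have h1 := congrFun (congrFun (Matrix.mem_unitaryGroup_iff'.1 hU) (0, k)) (0, j)
    rw [Matrix.star_mulVec, Matrix.conjTranspose_conjTranspose, dotProduct_comm,
      ← Matrix.dotProduct_mulVec, hv]
    simp only [Matrix.mul_apply, Matrix.star_apply, Matrix.one_apply, Prod.mk.injEq, true_and] at h1
    simpa [dotProduct, eq_comm] using h1
  obtain ⟨z, hz, hsum⟩ := exists_isotropic_decomposition hr hrr (v₁ := v 0) (v₂ := v 1)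
    (by simp [horth]) (by simp [horth]) (by simp [horth])
  refine mem_separableStates_of_sum_isotropic (N := 4 * r + 4) (by positivity)
    (conj_mem_states (twoLevelState_mem_states hr) hU).2 (fun k => magicBasis *ᵥ z k)
    (fun k => magicBasis_isotropic (hz k)) ?_
  rw [conj_twoLevelState hr hU]
  have := congrArg (fun M => magicBasis * M * magicBasisᴴ) hsum
  simp only [Matrix.mul_sum, Matrix.sum_mul, mul_vecMulVec_star_mul, Matrix.mul_add,
    Matrix.add_mul, Matrix.mul_smul, Matrix.smul_mul, Matrix.mul_one, smul_add,
    magicBasis_mul_conjTranspose, hv] at this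
  rw [this, smul_add]

end AbsoluteSeparability

end QState

theorem proposition5 :
    ∃ ρ : Matrix (Fin 2 × Fin 2) (Fin 2 × Fin 2) ℂ,
      ρ ∈ QState.absolutelySeparable (Fin 2) (Fin 2) ∧
      ρ.rank = 4 ∧
      ρ ∉ QState.maximalBall ∧
      ρ ∈ Set.extremePoints ℝ (QState.absolutelySeparable (Fin 2) (Fin 2)) := by
  have h2 : √2 ^ 2 = 2 := Real.sq_sqrt (by norm_num)
  have h2' : 0 < √2 := by positivity
  obtain ⟨r, hr, hrr⟩ : ∃ r : ℝ, 1 < r ∧ r ^ 2 = 2 * r + 1 :=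
    ⟨1 + √2, by linarith, by linear_combination h2⟩
  have hr0 : 0 < r := by linarith
  have hAS := QState.twoLevelState_mem_absolutelySeparable hr0 hrr
  refine ⟨QState.twoLevelState r, hAS, ?_, ?_, ?_⟩
  · rw [Matrix.rank_of_isUnit]
    · simp
    · rw [QState.twoLevelState, Matrix.isUnit_diagonal, Pi.isUnit_iff]
      intro i
      rw [isUnit_iff_ne_zero, Complex.ofReal_ne_zero]
      split_ifs <;> positivity
  · rintro ⟨-, h⟩
    have hp : QState.purity (QState.twoLevelState r) =
        2 * ((2 * r + 1) / (4 * r + 4)) ^ 2 + 2 * (1 / (4 * r + 4)) ^ 2 := by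
      rw [QState.purity, QState.twoLevelState, Matrix.diagonal_mul_diagonal, Matrix.trace_diagonal]
      simp only [← Complex.ofReal_mul, ← Complex.ofReal_sum, Complex.ofReal_re,
        Fintype.sum_prod_type, Fin.sum_univ_two]
      simp
      field_simp
      ring
    rw [hp, div_pow, div_pow, ← mul_div_assoc, ← mul_div_assoc, ← add_div,
      div_le_div_iff₀ (by positivity) (by norm_num)] at h
    -- By `r² = 2r + 1` the purity equals `3/8`, which exceeds `1/3`.
    nlinarith
  · refine mem_extremePoints.2 ⟨hAS, fun σ hσ τ hτ hmem => ?_⟩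
    obtain ⟨s, t, hs, ht, -, h⟩ := hmem
    exact ⟨QState.eq_twoLevelState hr hrr hσ hτ hs ht h,
      QState.eq_twoLevelState hr hrr hτ hσ ht hs (by rw [add_comm, h])⟩
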